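/- A \emph{wire} is a set $W$ with two operations $\star,\circ$ such that $(W,\star)$ is a group, $(W,\circ)$ is a semigroup, and $a\circ(b\star c)=(a\circ b)\star a^{-1}\star(a\circ c)$, $(b\star c)\circ a=(b\circ a)\star a^{-1}\star(c\circ a)$ for all $a,b,c\in W$ (inverses are taken with respect to $\star$). It is \emph{commutative} if $\circ$ is commutative. An \emph{isomorphism} of wires is a bijection that preserves both operations. Let $X$ be a set, let $(Y,\circ)$ be the free commutative semigroup on $X$ (nonempty commutative monomials in $X$), and let $(F,\star)$ be the free group on the set $Y$. For $u\in F$ and $m\in Y$ put $u\circ m=\rho_m(u)\star m$, where $\rho_m$ is the endomorphism of $F$ with $\rho_m(y)=(y\circ m)\star m^{-1}$ for $y\in Y$. For $u,v\in F$ put $u\circ_l v=u\star\lambda_u(v)$, where $\lambda_u$ is the endomorphism of $F$ with $\lambda_u(y)=u^{-1}\star(u\circ y)$ for $y\in Y$. Let $N$ be the normal subgroup of $F$ generated by the elements $m^{-1}\star (m\circ l)\star l^{-1}$ with $m,l\in Y$, and $N'=[N,N]$. With $[u]\circ[v]=[u\circ_l v]$, the quotient $F/N'$ is a commutative wire. For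 $s\in Y$ and $u=u_1^{\epsilon_1}\star\cdots\star u_n^{\epsilon_n}\in F$ with $u_i\in Y$ and $\epsilon_i=\pm1$, let $\frac{\partial u}{\partial s}\in\mathbb Z[F/N]$ be the image of the Fox derivative $\sum_{k:\,u_k=s}\epsilon_k u_{(k)}\in\mathbb Z[F]$, where $u_{(k)}=\prod_{i<k}u_i^{\epsilon_i}$ if $\epsilon_k=1$ and $u_{(k)}=\prod_{i\le k}u_i^{\epsilon_i}$ if $\epsilon_k=-1$. Put \[f_u=\Bigl(1-\sum_{s\in Y}\frac{\partial u}{\partial s}\Bigr)+\sum_{s\in Y}\frac{\partial u}{\partial s}\,t_s\in\mathbb Z[F/N][(t_x)_{x\in X}],\] where $t_s=t_{x_1}\cdots t_{x_i}$ if $s=x_1\circ\cdots\circ x_i$. Let $\mathrm{eval}_1,\mathrm{eval}_X:\mathbb Z[F/N][(t_x)_{x\in X}]\to\mathbb Z[F/N]$ be the $\mathbb Z[F/N]$-algebra morphisms with $t_x\mapsto 1$ and $t_x\mapsto[x]$ respectively, and let $\mathcal W(X)$ be the set of polynomials $f$ with $\mathrm{eval}_1(f)=1$ and $\mathrm{eval}_X(f)\in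 F/N$. With $f\star g=f+\mathrm{eval}_X(f)(g-1)$ and $f\circ g=fg$, it is a commutative wire. \textbf{Theorem.} The group $F/N$ is the free commutative group $\mathbb Z^{(X)}$ on the classes $[x]$, $x\in X$. The rule $[u]\mapsto f_u$ gives a well-defined map $\mathfrak d: F/N'\to\mathcal W(X)$, and $\mathfrak d$ is an isomorphism of wires. -/

import Mathlib

/-! ## Wires -/

/-- A wire `(W, ⋆, ∘)`. The group operation `⋆` is written multiplicatively (`*`), the
semigroup operation `∘` is written `⊚`. -/
class Wire (W : Type*) extends Group W where
  circ : W → W → W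
  circ_assoc : ∀ a b c : W, circ (circ a b) c = circ a (circ b c)
  circ_mul : ∀ a b c : W, circ a (b * c) = circ a b * a⁻¹ * circ a c
  mul_circ : ∀ a b c : W, circ (b * c) a = circ b a * a⁻¹ * circ c a

infixl:75 " ⊚ " => Wire.circ

/-- A commutative wire: `∘` is commutative (`⋆` need not be). -/
class CommWire (W : Type*) extends Wire W where
  circ_comm : ∀ a b : W, circ a b = circ b a

structure IsWireHom {W V : Type*} [Wire W] [Wire V] (f : W → V) : Prop where
  map_star : ∀ u v : W, f (u * v) = f u * f v
  map_circ : ∀ u v : W, f (u ⊚ v) = f u ⊚ f v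

structure IsWireIso {W V : Type*} [Wire W] [Wire V] (f : W → V) : Prop
    extends IsWireHom f where
  bijective : Function.Bijective f

/-! ## Fox calculus in a free group -/

namespace Fox

variable {Y : Type*}

/-- The initial section attached to position `k` of a word `u₁^ε₁ ⋯ uₙ^εₙ`: the product of the
letters strictly before position `k` if `ε_k = 1`, and of those up to and including position `k`
if `ε_k = -1`. Positions are numbered from `0`; the Boolean `true` stands for the exponent `1`. -/
def initialSection (L : List (Y × Bool)) (k : Fin L.length) : FreeGroup Y :=
  if (L.get k).2 then FreeGroup.mk (L.take k) else FreeGroup.mk (L.take (k + 1))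

open Classical in
/-- The Fox derivative of a (not necessarily reduced) word: `∑ ε_k u_(k)` over all positions `k`
whose letter is `s^{±1}`. -/
noncomputable def wordDeriv (s : Y) (L : List (Y × Bool)) : MonoidAlgebra ℤ (FreeGroup Y) :=
  ∑ k : Fin L.length,
    if (L.get k).1 = s then
      (if (L.get k).2 then (1 : ℤ) else -1) • MonoidAlgebra.of ℤ (FreeGroup Y) (initialSection L k)
    else 0

open Classical in
theorem wordDeriv_cons (s : Y) (a : Y × Bool) (L : List (Y × Bool)) :
    wordDeriv s (a :: L) =
      (if a.1 = s then
        (if a.2 then 1 else -MonoidAlgebra.of ℤ (FreeGroup Y) (FreeGroup.mk [a])) else 0) +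
      MonoidAlgebra.of ℤ (FreeGroup Y) (FreeGroup.mk [a]) * wordDeriv s L := by
  unfold wordDeriv
  rw [Finset.mul_sum]
  refine (Fin.sum_univ_succ (n := L.length) _).trans ?_
  congr 1
  · rcases a with ⟨y, b⟩
    cases b <;> simp [initialSection, ← FreeGroup.one_eq_mk] <;> rfl
  · refine Finset.sum_congr rfl fun k _ => ?_
    have h : initialSection (a :: L) k.succ = FreeGroup.mk [a] * initialSection L k := by
      simp [initialSection]
    by_cases h1 : (L.get k).1 = s
    · have h1' : ((a :: L).get k.succ).1 = s := h1
      rw [if_pos h1, if_pos h1', h, map_mul, mul_smul_comm]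
      rfl
    · have h1' : ¬ ((a :: L).get k.succ).1 = s := h1
      rw [if_neg h1, if_neg h1', mul_zero]

theorem wordDeriv_append (s : Y) (L M : List (Y × Bool)) :
    wordDeriv s (L ++ M) =
      wordDeriv s L + MonoidAlgebra.of ℤ (FreeGroup Y) (FreeGroup.mk L) * wordDeriv s M := by
  induction L with
  | nil =>
    have h : wordDeriv s ([] : List (Y × Bool)) = 0 := rfl
    rw [List.nil_append, h, ← FreeGroup.one_eq_mk, map_one, one_mul, zero_add]
  | cons a L ih =>
    have h : FreeGroup.mk (a :: L) = FreeGroup.mk [a] * FreeGroup.mk L := by simp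
    rw [List.cons_append, wordDeriv_cons, ih, wordDeriv_cons, h, map_mul]
    noncomm_ring

theorem wordDeriv_step (s : Y) (L M : List (Y × Bool)) (h : FreeGroup.Red.Step L M) :
    wordDeriv s L = wordDeriv s M := by
  obtain ⟨⟩ := h
  rename_i L₁ L₂ x b
  rw [wordDeriv_append, wordDeriv_append, wordDeriv_cons, wordDeriv_cons]
  congr 2
  have h1 : FreeGroup.mk [(x, b)] * FreeGroup.mk [(x, !b)] = 1 := by
    rw [FreeGroup.mul_mk, FreeGroup.one_eq_mk]
    exact Quot.sound (FreeGroup.Red.Step.not (L₁ := []) (L₂ := []))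
  have h2 : MonoidAlgebra.of ℤ (FreeGroup Y) (FreeGroup.mk [(x, b)]) *
      MonoidAlgebra.of ℤ (FreeGroup Y) (FreeGroup.mk [(x, !b)]) = 1 := by
    rw [← map_mul, h1, map_one]
  rw [mul_add, ← mul_assoc, h2, one_mul, ← add_assoc]
  cases b <;> by_cases hx : x = s <;> simp only [hx, if_true, if_false] <;> simp_all

/-- The Fox derivative `∂u/∂s` of an element of the free group, computed from any word that
represents it. -/
noncomputable def deriv (s : Y) : FreeGroup Y → MonoidAlgebra ℤ (FreeGroup Y) :=
  Quot.lift (wordDeriv s) (wordDeriv_step s)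

/-- Only finitely many Fox derivatives of a given element are nonzero. -/
theorem finite_deriv_ne_zero (u : FreeGroup Y) : {s : Y | deriv s u ≠ 0}.Finite := by
  classical
  induction u using Quot.inductionOn with
  | _ L =>
    refine (L.map Prod.fst).toFinset.finite_toSet.subset fun s hs => ?_
    by_contra hn
    refine hs ?_
    change wordDeriv s L = 0
    refine Finset.sum_eq_zero fun k _ => if_neg fun hk => hn ?_
    simp only [List.coe_toFinset, List.mem_map, Set.mem_ofPred_eq]
    exact ⟨L.get k, List.get_mem _ _, hk⟩

end Fox

/-! ## The free commutative wire `F/N'` -/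

namespace FreeCommWire

/-- The free commutative semigroup on `X`: nonzero finitely supported exponent vectors, the
vector `s` standing for the product of the `x ^ s x`. -/
def Mono (X : Type*) : Type _ := {s : X →₀ ℕ // s ≠ 0}

variable {X : Type*}

noncomputable instance : CommSemigroup (Mono X) where
  mul s t := ⟨s.1 + t.1, fun h => s.2 (add_eq_zero.mp h).1⟩
  mul_assoc s t r := Subtype.ext (add_assoc s.1 t.1 r.1)
  mul_comm s t := Subtype.ext (add_comm s.1 t.1)

/-- The generator `x` as a monomial. -/
noncomputable def Mono.var (x : X) : Mono X := ⟨Finsupp.single x 1, by simp⟩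

/-- `F`, the free group on the set of monomials. Its operation is `⋆`. -/
abbrev F (X : Type*) := FreeGroup (Mono X)

/-- A monomial as a generator of `F`. -/
abbrev gen (m : Mono X) : F X := FreeGroup.of m

/-- `ρ_l` for a monomial `l`: the endomorphism of `F` with `m ↦ (m ∘ l) ⋆ l⁻¹`. -/
noncomputable def rhoMono (l : Mono X) : F X →* F X := FreeGroup.lift fun m => gen (m * l) * (gen l)⁻¹

/-- `λ_l` for a monomial `l`: the endomorphism of `F` with `m ↦ l⁻¹ ⋆ (l ∘ m)`. -/
noncomputable def lamMono (l : Mono X) : F X →* F X := FreeGroup.lift fun m => (gen l)⁻¹ * gen (l * m)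

/-- `λ_u` for a word `u`: the endomorphism of `F` with `m ↦ u⁻¹ ⋆ (u ∘ m)`, where
`u ∘ m = ρ_m(u) ⋆ m`. -/
noncomputable def lam (u : F X) : F X →* F X := FreeGroup.lift fun m => u⁻¹ * (rhoMono m u * gen m)

/-- `ρ_v` for a word `v`: the endomorphism of `F` with `m ↦ (m ∘ v) ⋆ v⁻¹`, where
`m ∘ v = m ⋆ λ_m(v)`. -/
noncomputable def rho (v : F X) : F X →* F X := FreeGroup.lift fun m => (gen m * lamMono m v) * v⁻¹

/-- `u ∘_l v = u ⋆ λ_u(v)`. -/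
noncomputable def circL (u v : F X) : F X := u * lam u v

/-- `u ∘_r v = ρ_v(u) ⋆ v`. -/
noncomputable def circR (u v : F X) : F X := rho v u * v

/-- `N`, the normal subgroup of `F` generated by the elements `m⁻¹ ⋆ (m ∘ l) ⋆ l⁻¹`. -/
def N (X : Type*) : Subgroup (F X) :=
  Subgroup.normalClosure {w | ∃ m l : Mono X, w = (gen m)⁻¹ * gen (m * l) * (gen l)⁻¹}

instance : (N X).Normal := Subgroup.normalClosure_normal

/-- The group `F/N`. -/
abbrev FmodN (X : Type*) := F X ⧸ N X

/-- The group `F/N'` with `N' = [N, N]`. -/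
abbrev FmodN' (X : Type*) := F X ⧸ ⁅N X, N X⁆

/-- The projection `F → F/N`. -/
abbrev toN : F X →* FmodN X := QuotientGroup.mk' (N X)

/-- The projection `F → F/N'`. -/
abbrev toN' : F X →* FmodN' X := QuotientGroup.mk' ⁅N X, N X⁆

theorem toN_gen_mul (m l : Mono X) : toN (gen (m * l)) = toN (gen m) * toN (gen l) := by
  have h : toN ((gen m)⁻¹ * gen (m * l) * (gen l)⁻¹) = 1 :=
    (QuotientGroup.eq_one_iff _).mpr (Subgroup.subset_normalClosure ⟨m, l, rfl⟩)
  rw [map_mul, map_mul, map_inv, map_inv, mul_inv_eq_one, inv_mul_eq_iff_eq_mul] at h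
  exact h

theorem toN_comm (u v : F X) : toN u * toN v = toN v * toN u := by
  have key : ∀ a b : Mono X, Commute (toN (gen a)) (toN (gen b)) := fun a b => by
    rw [commute_iff_eq, ← toN_gen_mul, mul_comm, toN_gen_mul]
  have key2 : ∀ (a : Mono X) (v : F X), Commute (toN (gen a)) (toN v) := fun a v => by
    induction v using FreeGroup.induction_on with
    | C1 => rw [map_one]; exact Commute.one_right _
    | of b => exact key a b
    | inv_of b h => rw [map_inv]; exact h.inv_right
    | mul x y hx hy => rw [map_mul]; exact hx.mul_right hy
  have key3 : Commute (toN u) (toN v) := by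
    induction u using FreeGroup.induction_on with
    | C1 => rw [map_one]; exact Commute.one_left _
    | of b => exact key2 b v
    | inv_of b h => rw [map_inv]; exact h.inv_left
    | mul x y hx hy => rw [map_mul]; exact hx.mul_left hy
  exact key3

instance : CommGroup (FmodN X) where
  mul_comm a b := by
    induction a using QuotientGroup.induction_on
    induction b using QuotientGroup.induction_on
    exact toN_comm _ _

theorem toN_rhoMono (l : Mono X) (u : F X) : toN (rhoMono l u) = toN u := by
  have h : toN.comp (rhoMono l) = toN := by
    ext m
    simp only [MonoidHom.comp_apply, rhoMono, FreeGroup.lift_apply_of, map_mul, map_inv,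
      toN_gen_mul, mul_inv_cancel_right]
  exact DFunLike.congr_fun h u

theorem toN_lamMono (l : Mono X) (u : F X) : toN (lamMono l u) = toN u := by
  have h : toN.comp (lamMono l) = toN := by
    ext m
    simp only [MonoidHom.comp_apply, lamMono, FreeGroup.lift_apply_of, map_mul, map_inv,
      toN_gen_mul, inv_mul_cancel_left]
  exact DFunLike.congr_fun h u

theorem toN_lam (v u : F X) : toN (lam v u) = toN u := by
  have h : toN.comp (lam v) = toN := by
    ext m
    simp only [MonoidHom.comp_apply, lam, FreeGroup.lift_apply_of, map_mul, map_inv,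
      toN_rhoMono, inv_mul_cancel_left]
  exact DFunLike.congr_fun h u

theorem toN_rho (v u : F X) : toN (rho v u) = toN u := by
  have h : toN.comp (rho v) = toN := by
    ext m
    simp only [MonoidHom.comp_apply, rho, FreeGroup.lift_apply_of, map_mul, map_inv,
      toN_lamMono, mul_inv_cancel_right]
  exact DFunLike.congr_fun h u

theorem toN'_congr {φ : F X →* F X} (hφ : ∀ u, toN (φ u) = toN u) {u v : F X}
    (h : toN' u = toN' v) : toN' (φ u) = toN' (φ v) := by
  have h1 : N X ≤ (N X).comap φ := fun n hn =>
    (QuotientGroup.eq_one_iff (φ n)).mp ((hφ n).trans ((QuotientGroup.eq_one_iff _).mpr hn))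
  have h2 : ⁅N X, N X⁆ ≤ ⁅N X, N X⁆.comap φ := by
    rw [← Subgroup.map_le_iff_le_comap, Subgroup.map_commutator]
    exact Subgroup.commutator_mono (Subgroup.map_le_iff_le_comap.mpr h1)
      (Subgroup.map_le_iff_le_comap.mpr h1)
  have h3 : u⁻¹ * v ∈ ⁅N X, N X⁆ := QuotientGroup.eq.mp h
  have h4 := h2 h3
  rw [Subgroup.mem_comap, map_mul, map_inv] at h4
  exact QuotientGroup.eq.mpr h4

/-- `F/N` acts by conjugation on `N/N'`. -/
theorem toN'_conj {a b n : F X} (hab : toN a = toN b) (hn : toN n = 1) :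
    toN' (a * n * a⁻¹) = toN' (b * n * b⁻¹) := by
  have h1 : a⁻¹ * b ∈ N X := QuotientGroup.eq.mp hab
  have h2 : n ∈ N X := (QuotientGroup.eq_one_iff n).mp hn
  have h3 := Subgroup.commutator_mem_commutator ((N X).inv_mem h2) h1
  have h4 := (inferInstance : (⁅N X, N X⁆ : Subgroup (F X)).Normal).conj_mem _ h3 a
  refine QuotientGroup.eq.mpr ?_
  convert h4 using 1
  rw [commutatorElement_def]
  group

theorem circR_eq_circL (u v : F X) : circR u v = circL v u := by
  have h1 : ∀ m : Mono X, gen m * lamMono m v = rhoMono m v * gen m := fun m => by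
    have h : (MulAut.conj (gen m)).toMonoidHom.comp (lamMono m) = rhoMono m := by
      ext l
      simp [lamMono, rhoMono, mul_comm]
    rw [← h]
    simp
  have h2 : rho v = (MulAut.conj v).toMonoidHom.comp (lam v) := by
    ext m
    simp [rho, lam, h1]
  rw [circR, circL, h2]
  simp

theorem rho_mul (v w u : F X) :
    toN' (rho (v * w) u) = toN' (rho v u * (v * (u⁻¹ * rho w u) * v⁻¹)) := by
  have hN : ∀ u, toN (u⁻¹ * rho w u) = 1 := fun u => by
    rw [map_mul, map_inv, toN_rho, inv_mul_cancel]
  let φ : F X →* FmodN' X := MonoidHom.mk'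
    (fun u => toN' (rho v u * (v * (u⁻¹ * rho w u) * v⁻¹))) (by
      intro a b
      have hc : toN (rho v b * v * b⁻¹) = toN v := by
        rw [map_mul, map_mul, map_inv, toN_rho, mul_comm (toN b), mul_inv_cancel_right]
      have key := toN'_conj hc (hN a)
      calc toN' (rho v (a * b) * (v * ((a * b)⁻¹ * rho w (a * b)) * v⁻¹))
          = toN' (rho v a) * toN' ((rho v b * v * b⁻¹) * (a⁻¹ * rho w a) *
              (rho v b * v * b⁻¹)⁻¹) * toN' (rho v b * (v * (b⁻¹ * rho w b) * v⁻¹)) := by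
            rw [← map_mul, ← map_mul, map_mul (rho v), map_mul (rho w)]
            congr 1
            group
        _ = _ := by rw [key]; simp only [← map_mul, mul_assoc])
  have h : toN'.comp (rho (v * w)) = φ := by
    ext m
    simp only [φ, MonoidHom.comp_apply, MonoidHom.mk'_apply]
    congr 1
    simp only [rho, FreeGroup.lift_apply_of, map_mul]
    group
  exact DFunLike.congr_fun h u

theorem toN'_circL_eq_circR (u v : F X) : toN' (circL u v) = toN' (circR u v) := by
  let φ : F X →* FmodN' X := MonoidHom.mk' (fun v => toN' (u⁻¹ * circR u v)) (by
    intro a b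
    have h : toN' (circR u (a * b)) = toN' (circR u a * u⁻¹ * circR u b) := by
      rw [circR, map_mul, rho_mul, ← map_mul]
      congr 1
      simp only [circR]
      group
    rw [map_mul, h, ← map_mul, ← map_mul]
    congr 1
    group)
  have h : toN'.comp (lam u) = φ := by
    ext m
    have h2 : rhoMono m u = rho (gen m) u := by
      have : rhoMono m = rho (gen m) := by
        ext l
        simp [rhoMono, rho, lamMono]
      rw [this]
    simp [φ, lam, circR, h2]
  have h3 : toN' (lam u v) = toN' (u⁻¹ * circR u v) := DFunLike.congr_fun h v
  rw [circL, map_mul, h3, ← map_mul, mul_inv_cancel_left]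

theorem toN'_circL_congr {u u' v v' : F X} (hu : toN' u = toN' u') (hv : toN' v = toN' v') :
    toN' (circL u v) = toN' (circL u' v') := by
  have h : ∀ {u u' : F X}, toN' u = toN' u' → ∀ v, toN' (circL v u) = toN' (circL v u') :=
    fun h v => by rw [circL, circL, map_mul, map_mul, toN'_congr (toN_lam v) h]
  rw [h hv u, toN'_circL_eq_circR, circR_eq_circL, h hu v', ← circR_eq_circL,
    ← toN'_circL_eq_circR]

/-- The operation `[u] ∘ [v] = [u ∘_l v]` on `F/N'`; it is also `[u ∘_r v]`, by
`toN'_circL_eq_circR`. -/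
noncomputable def circ : FmodN' X → FmodN' X → FmodN' X :=
  Quotient.map₂ circL fun _ _ hu _ _ hv => Quotient.exact
    (toN'_circL_congr (Quotient.sound hu) (Quotient.sound hv))

theorem circ_toN' (u v : F X) : circ (toN' u) (toN' v) = toN' (circL u v) := rfl

theorem circ_comm (a b : FmodN' X) : circ a b = circ b a := by
  induction a using QuotientGroup.induction_on with | H u =>
  induction b using QuotientGroup.induction_on with | H v =>
  exact (toN'_circL_eq_circR u v).trans (congrArg toN' (circR_eq_circL u v))

theorem circ_mul (a b c : FmodN' X) : circ a (b * c) = circ a b * a⁻¹ * circ a c := by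
  induction a using QuotientGroup.induction_on with | H u =>
  induction b using QuotientGroup.induction_on with | H v =>
  induction c using QuotientGroup.induction_on with | H w =>
  change toN' (circL u (v * w)) = toN' (circL u v) * (toN' u)⁻¹ * toN' (circL u w)
  rw [← map_inv, ← map_mul, ← map_mul]
  congr 1
  simp only [circL, map_mul]
  group

theorem circ_one (a : FmodN' X) : circ a 1 = a := by
  induction a using QuotientGroup.induction_on with | H u =>
  change toN' (circL u 1) = toN' u
  simp [circL]

theorem circ_heap (a b c d : FmodN' X) :
    circ a (b * c⁻¹ * d) = circ a b * (circ a c)⁻¹ * circ a d := by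
  have h : circ a c⁻¹ = a * (circ a c)⁻¹ * a := by
    have h1 := circ_mul a c c⁻¹
    rw [mul_inv_cancel, circ_one] at h1
    rw [mul_assoc, ← inv_mul_eq_iff_eq_mul] at h1
    rw [mul_assoc, h1, mul_inv_cancel_left]
  rw [circ_mul, circ_mul, h]
  group

theorem affine_ext {g h : FmodN' X → FmodN' X}
    (hg : ∀ a b, g (a * b) = g a * (g 1)⁻¹ * g b) (hh : ∀ a b, h (a * b) = h a * (h 1)⁻¹ * h b)
    (h1 : g 1 = h 1) (h2 : ∀ m : Mono X, g (toN' (gen m)) = h (toN' (gen m)))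
    (a : FmodN' X) : g a = h a := by
  induction a using QuotientGroup.induction_on with | H u =>
  let φ : F X →* FmodN' X := MonoidHom.mk' (fun u => (g 1)⁻¹ * g (toN' u)) (by
    intro a b
    rw [map_mul, hg]
    group)
  let ψ : F X →* FmodN' X := MonoidHom.mk' (fun u => (h 1)⁻¹ * h (toN' u)) (by
    intro a b
    rw [map_mul, hh]
    group)
  have : φ = ψ := by
    ext m
    simp only [φ, ψ, MonoidHom.mk'_apply, h1]
    exact congrArg _ (h2 m)
  have h3 : (g 1)⁻¹ * g (toN' u) = (h 1)⁻¹ * h (toN' u) := DFunLike.congr_fun this u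
  rw [h1] at h3
  exact mul_left_cancel h3

theorem circ_gen (m l : Mono X) :
    circ (toN' (gen m)) (toN' (gen l)) = toN' (gen (m * l)) := by
  rw [circ_toN']
  simp [circL, lam, rhoMono]

theorem circ_assoc (a b c : FmodN' X) : circ (circ a b) c = circ a (circ b c) := by
  have one_circ : ∀ a : FmodN' X, circ 1 a = a := fun a => by rw [circ_comm, circ_one]
  have mul_circ : ∀ a b c : FmodN' X, circ (b * c) a = circ b a * a⁻¹ * circ c a :=
    fun a b c => by rw [circ_comm, circ_mul, circ_comm a b, circ_comm a c]
  have heap_circ : ∀ a b c d : FmodN' X,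
      circ (b * c⁻¹ * d) a = circ b a * (circ c a)⁻¹ * circ d a :=
    fun a b c d => by rw [circ_comm, circ_heap, circ_comm a b, circ_comm a c, circ_comm a d]
  refine affine_ext (g := fun c => circ (circ a b) c) (h := fun c => circ a (circ b c))
    (fun x y => ?_) (fun x y => ?_) ?_ (fun m => ?_) c
  · simp only [circ_mul, circ_one]
  · simp only [circ_mul b, circ_heap, circ_one]
  · simp only [circ_one]
  refine affine_ext (g := fun b => circ (circ a b) (toN' (gen m)))
    (h := fun b => circ a (circ b (toN' (gen m))))
    (fun x y => ?_) (fun x y => ?_) ?_ (fun l => ?_) b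
  · simp only [circ_mul, circ_one, heap_circ]
  · simp only [mul_circ _ x y, circ_heap, one_circ]
  · simp only [circ_one, one_circ]
  refine affine_ext (g := fun a => circ (circ a (toN' (gen l))) (toN' (gen m)))
    (h := fun a => circ a (circ (toN' (gen l)) (toN' (gen m))))
    (fun x y => ?_) (fun x y => ?_) ?_ (fun k => ?_) a
  · simp only [mul_circ _ x y, heap_circ, one_circ]
  · simp only [mul_circ _ x y, one_circ]
  · simp only [one_circ]
  · simp only [circ_gen, mul_assoc]

/-- The commutative wire `F/N'`. -/
noncomputable instance : CommWire (FmodN' X) where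
  circ := circ
  circ_assoc := circ_assoc
  circ_mul := circ_mul
  mul_circ a b c := by rw [circ_comm, circ_mul, circ_comm a b, circ_comm a c]
  circ_comm := circ_comm

/-! ## The commutative wire `𝒲(X)` -/

/-- The group algebra `ℤ[F/N]`. -/
abbrev Coeff (X : Type*) := MonoidAlgebra ℤ (FmodN X)

/-- An element of `F/N` inside `ℤ[F/N]`. -/
noncomputable abbrev emb : FmodN X →* Coeff X := MonoidAlgebra.of ℤ (FmodN X)

/-- Evaluation at `t_x ↦ 1`. -/
noncomputable def evalOne : MvPolynomial X (Coeff X) →+* Coeff X :=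
  MvPolynomial.eval fun _ => 1

/-- Evaluation at `t_x ↦ [x]`. -/
noncomputable def evalX : MvPolynomial X (Coeff X) →+* Coeff X :=
  MvPolynomial.eval fun x => emb (toN (gen (Mono.var x)))

/-- The polynomials `f` over `ℤ[F/N]` with `eval_1 f = 1` and `eval_X f ∈ F/N`. -/
@[ext]
structure PolyWire (X : Type*) where
  poly : MvPolynomial X (Coeff X)
  evalOne_poly : evalOne poly = 1
  evalX_poly : ∃ g : FmodN X, evalX poly = emb g

namespace PolyWire

theorem evalX_C (a : Coeff X) : evalX (MvPolynomial.C a) = a := MvPolynomial.eval_C a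

/-- `f ⋆ g = f + eval_X(f) (g - 1)`. -/
noncomputable def star (f g : PolyWire X) : PolyWire X where
  poly := f.poly + MvPolynomial.C (evalX f.poly) * (g.poly - 1)
  evalOne_poly := by simp [f.evalOne_poly, g.evalOne_poly]
  evalX_poly := by
    obtain ⟨a, ha⟩ := f.evalX_poly
    obtain ⟨b, hb⟩ := g.evalX_poly
    refine ⟨a * b, ?_⟩
    simp only [map_add, map_mul, map_sub, map_one, evalX_C, ha, hb]
    ring

/-- `f ∘ g = f g`. -/
noncomputable def circ (f g : PolyWire X) : PolyWire X where
  poly := f.poly * g.poly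
  evalOne_poly := by simp [f.evalOne_poly, g.evalOne_poly]
  evalX_poly := by
    obtain ⟨a, ha⟩ := f.evalX_poly
    obtain ⟨b, hb⟩ := g.evalX_poly
    exact ⟨a * b, by simp only [map_mul, ha, hb]⟩

/-- The neutral element of `⋆`. -/
noncomputable def one : PolyWire X := ⟨1, map_one _, 1, by rw [map_one, map_one]⟩

/-- The inverse of `eval_X f` in `ℤ[F/N]`. -/
noncomputable def evalXInv (f : PolyWire X) : Coeff X := emb f.evalX_poly.choose⁻¹

theorem evalXInv_mul (f : PolyWire X) : evalXInv f * evalX f.poly = 1 := by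
  have h := f.evalX_poly.choose_spec
  rw [h, evalXInv, ← map_mul, inv_mul_cancel, map_one]

/-- The `⋆`-inverse `1 - eval_X(f)⁻¹ (f - 1)`. -/
noncomputable def inv (f : PolyWire X) : PolyWire X where
  poly := 1 - MvPolynomial.C (evalXInv f) * (f.poly - 1)
  evalOne_poly := by simp [f.evalOne_poly]
  evalX_poly := by
    refine ⟨f.evalX_poly.choose⁻¹, ?_⟩
    simp only [map_sub, map_mul, map_one, evalX_C, mul_sub, evalXInv_mul]
    rw [evalXInv]
    ring

theorem evalX_inv (f : PolyWire X) : evalX (inv f).poly = evalXInv f := by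
  simp only [inv, map_sub, map_mul, map_one, evalX_C, mul_sub, evalXInv_mul]
  ring

noncomputable instance : Group (PolyWire X) :=
  letI : Mul (PolyWire X) := ⟨star⟩
  letI : One (PolyWire X) := ⟨one⟩
  letI : Inv (PolyWire X) := ⟨inv⟩
  Group.ofLeftAxioms
    (fun f g h => PolyWire.ext (by
      change (star (star f g) h).poly = (star f (star g h)).poly
      simp only [star, map_add, map_mul, map_sub, map_one, evalX_C]
      ring))
    (fun f => PolyWire.ext (by
      change (star one f).poly = f.poly
      simp [star, one]))
    (fun f => PolyWire.ext (by
      change (star (inv f) f).poly = 1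
      simp only [star, evalX_inv]
      simp only [inv]
      ring))

theorem mul_poly (f g : PolyWire X) :
    (f * g).poly = f.poly + MvPolynomial.C (evalX f.poly) * (g.poly - 1) := rfl

theorem inv_poly (f : PolyWire X) :
    (f⁻¹).poly = 1 - MvPolynomial.C (evalXInv f) * (f.poly - 1) := rfl

theorem circ_comm (f g : PolyWire X) : circ f g = circ g f :=
  PolyWire.ext (mul_comm f.poly g.poly)

theorem circ_mul (f g h : PolyWire X) : circ f (g * h) = circ f g * f⁻¹ * circ f h := by
  have hf : MvPolynomial.C (σ := X) (evalXInv f) * MvPolynomial.C (evalX f.poly) = 1 := by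
    rw [← map_mul, evalXInv_mul, map_one]
  refine PolyWire.ext ?_
  simp only [circ, mul_poly, inv_poly, map_add, map_mul, map_sub, map_one, evalX_C]
  linear_combination
    (MvPolynomial.C (evalX g.poly) * (f.poly - 1) +
      MvPolynomial.C (evalX g.poly) * (MvPolynomial.C (evalX f.poly) - 1) *
        (f.poly * h.poly - 1)) * hf

/-- The commutative wire `𝒲(X)`. -/
noncomputable instance : CommWire (PolyWire X) where
  circ := circ
  circ_assoc f g h := PolyWire.ext (mul_assoc f.poly g.poly h.poly)
  circ_mul := circ_mul
  mul_circ f g h := by rw [circ_comm, circ_mul, circ_comm f g, circ_comm f h]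
  circ_comm := circ_comm

end PolyWire

/-! ## The polynomial of a word -/

/-- The residue of the Fox derivative `∂u/∂s` in `ℤ[F/N]`. -/
noncomputable def foxDeriv (s : Mono X) (u : F X) : Coeff X :=
  MonoidAlgebra.mapDomainRingHom ℤ toN (Fox.deriv s u)

/-- `f_u = (1 - ∑ₛ ∂u/∂s) + ∑ₛ (∂u/∂s) t_s`, where `t_s` is the monomial with exponent vector `s`.
The sums have finitely many nonzero terms, see `Fox.finite_deriv_ne_zero`. -/
noncomputable def foxPoly (u : F X) : MvPolynomial X (Coeff X) :=
  MvPolynomial.C (1 - ∑ᶠ s : Mono X, foxDeriv s u) +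
    ∑ᶠ s : Mono X, MvPolynomial.C (foxDeriv s u) * MvPolynomial.monomial s.1 1

end FreeCommWire

/-!
Put `G = F/N`. The vector of all Fox derivatives of a word, with coefficients reduced to `ℤ[G]`,
is a crossed homomorphism `F → ℤ[G]^(Y)`, the gradient. It vanishes exactly on `[N, N]`, and
`x ∈ ℤ[G]^(Y)` is the gradient of a word if and only if the map `∂` with `e_y ↦ [y] - 1` sends `x`
to `g - 1` for some `g ∈ G`. Both facts come from Schreier rewriting along a set-theoretic section
`σ` of `F → G`: the additive map `ℤ[G]^(Y) → N^ab` with `a e_y ↦ [σ(a) y σ(a[y])⁻¹]` is a left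
inverse of the gradient `N^ab → ℤ[G]^(Y)`, and in the other order the composite is
`x ↦ x - s(∂ x)`, where `s(a)` is the gradient of `σ(a)`.

The polynomials `t_s - 1` form a basis of the kernel of `eval_1`, and
`f_u - 1 = ∑ₛ (∂u/∂s) (t_s - 1)`. Under this identification of gradients with polynomials `eval_X`
becomes `∂`, so `u ↦ f_u` maps `F` onto `𝒲(X)` with kernel `N'`. Compatibility with `∘` reduces to
the monomials, because in a wire `a ↦ (a ∘ b) ⋆ b⁻¹` and `b ↦ a⁻¹ ⋆ (a ∘ b)` are homomorphisms.
-/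

theorem abelianization_of_eq_one_iff {F : Type*} [Group F] {K : Subgroup F} {n : K} :
    Abelianization.of n = 1 ↔ (n : F) ∈ ⁅K, K⁆ := by
  rw [← MonoidHom.mem_ker, Abelianization.ker_of, ← Subgroup.map_subtype_commutator]
  exact (Subgroup.mem_map_iff_mem K.subtype_injective).symm

theorem finsum_eq_finsuppSum {α M A : Type*} [Zero M] [AddCommMonoid A] (f : α →₀ M)
    {h : α → M → A} (h_zero : ∀ a, h a 0 = 0) : ∑ᶠ a, h a (f a) = f.sum h :=
  finsum_eq_sum_of_support_subset _ fun a ha =>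
    Finsupp.mem_support_iff.mpr fun hfa => ha ((congrArg (h a) hfa).trans (h_zero a))

namespace Fox

open MonoidAlgebra (of)

theorem crossedHom_ext {Y M : Type*} [AddCommGroup M] {ρ : FreeGroup Y → M →+ M}
    (hρ : ∀ x, ρ 1 x = x) {δ ε : FreeGroup Y → M}
    (hδ : ∀ u v, δ (u * v) = δ u + ρ u (δ v)) (hε : ∀ u v, ε (u * v) = ε u + ρ u (ε v))
    (h : ∀ y, δ (FreeGroup.of y) = ε (FreeGroup.of y)) : δ = ε := by
  have map_one {η : FreeGroup Y → M} (hη : ∀ u v, η (u * v) = η u + ρ u (η v)) : η 1 = 0 := by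
    simpa only [mul_one, hρ, left_eq_add] using hη 1 1
  funext u
  induction u using FreeGroup.induction_on with
  | C1 => rw [map_one hδ, map_one hε]
  | of y => exact h y
  | inv_of y hy =>
    have hδ' := hδ (FreeGroup.of y)⁻¹ (FreeGroup.of y)
    have hε' := hε (FreeGroup.of y)⁻¹ (FreeGroup.of y)
    rw [inv_mul_cancel, map_one hδ] at hδ'
    rw [inv_mul_cancel, map_one hε, ← hy, hδ'] at hε'
    exact add_right_cancel hε'
  | mul u v hu hv => rw [hδ, hε, hu, hv]

section Schreier

variable {F G : Type*} [Group F] [Group G] {π : F →* G} {σ : G → F}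

/-- The class in the abelianization of `ker π` of the Schreier element `σ(a) u σ(a π(u))⁻¹`
attached to a section `σ` of `π`. -/
def schreierClass (hσ : Function.RightInverse σ π) (u : F) (a : G) :
    Additive (Abelianization π.ker) :=
  .ofMul (.of ⟨σ a * u * (σ (a * π u))⁻¹, by
    rw [MonoidHom.mem_ker, map_mul, map_mul, map_inv, hσ, hσ, mul_inv_cancel]⟩)

theorem schreierClass_mul (hσ : Function.RightInverse σ π) (u v : F) (a : G) :
    schreierClass hσ (u * v) a = schreierClass hσ u a + schreierClass hσ v (a * π u) := by
  rw [schreierClass, schreierClass, schreierClass, ← ofMul_mul, ← map_mul]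
  congr 2
  ext
  simp only [Subgroup.coe_mul, map_mul, mul_assoc, inv_mul_cancel_left]

theorem schreierClass_one_eq_zero_iff (hσ : Function.RightInverse σ π) {u : F}
    (hu : u ∈ π.ker) : schreierClass hσ u 1 = 0 ↔ u ∈ ⁅π.ker, π.ker⁆ := by
  refine Iff.trans abelianization_of_eq_one_iff ?_
  change σ 1 * u * (σ (1 * π u))⁻¹ ∈ ⁅π.ker, π.ker⁆ ↔ _
  rw [MonoidHom.mem_ker.mp hu, mul_one, mul_assoc, Subgroup.Normal.mem_comm_iff inferInstance,
    inv_mul_cancel_right]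

end Schreier

section Gradient

variable {Y G : Type*} [Group G] (π : FreeGroup Y →* G)

theorem deriv_mul (s : Y) (u v : FreeGroup Y) :
    deriv s (u * v) = deriv s u + of ℤ (FreeGroup Y) u * deriv s v := by
  induction u using Quot.inductionOn with | _ L =>
  induction v using Quot.inductionOn with | _ M =>
  exact wordDeriv_append s L M

open Classical in
theorem deriv_of (s y : Y) : deriv s (FreeGroup.of y) = if y = s then 1 else 0 := by
  change wordDeriv s [(y, true)] = _
  rw [wordDeriv_cons]
  simp [wordDeriv]

/-- The Fox gradient of `u` along `π`: the family of the residues in `ℤ[G]` of all the Fox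
derivatives `∂u/∂s`. -/
noncomputable def gradient (u : FreeGroup Y) : Y →₀ MonoidAlgebra ℤ G :=
  Finsupp.ofSupportFinite (fun s => MonoidAlgebra.mapDomainRingHom ℤ π (deriv s u))
    ((finite_deriv_ne_zero u).subset fun _ hs h => hs (by simp only [h, map_zero]))

theorem gradient_apply (u : FreeGroup Y) (s : Y) :
    gradient π u s = MonoidAlgebra.mapDomainRingHom ℤ π (deriv s u) := rfl

theorem gradient_mul (u v : FreeGroup Y) :
    gradient π (u * v) = gradient π u + of ℤ G (π u) • gradient π v := by
  have map_of : MonoidAlgebra.mapDomainRingHom ℤ π (of ℤ _ u) = of ℤ G (π u) :=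
    MonoidAlgebra.mapDomain_single
  ext1 s
  rw [Finsupp.add_apply, Finsupp.smul_apply, smul_eq_mul, gradient_apply, gradient_apply,
    gradient_apply, deriv_mul, map_add, map_mul, map_of]

theorem gradient_of (y : Y) : gradient π (FreeGroup.of y) = Finsupp.single y 1 := by
  classical
  ext1 s
  rw [gradient_apply, deriv_of, Finsupp.single_apply]
  split_ifs
  · exact map_one _
  · exact map_zero _

theorem gradient_mul_of_mem_ker {n : FreeGroup Y} (hn : n ∈ π.ker) (u : FreeGroup Y) :
    gradient π (n * u) = gradient π n + gradient π u := by
  rw [gradient_mul, MonoidHom.mem_ker.mp hn, map_one, one_smul]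

/-- The `ℤ[G]`-linear map `ℤ[G]^(Y) → ℤ[G]` that sends the basis vector of `y` to `π(y) - 1`. -/
noncomputable def boundary : (Y →₀ MonoidAlgebra ℤ G) →ₗ[MonoidAlgebra ℤ G] MonoidAlgebra ℤ G :=
  Finsupp.linearCombination _ fun y => of ℤ G (π (FreeGroup.of y)) - 1

theorem boundary_gradient (u : FreeGroup Y) :
    boundary π (gradient π u) = of ℤ G (π u) - 1 := by
  let ρ (u : FreeGroup Y) : MonoidAlgebra ℤ G →+ MonoidAlgebra ℤ G :=
    AddMonoidHom.mulLeft (of ℤ G (π u))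
  have hρ (x : MonoidAlgebra ℤ G) : ρ 1 x = x := by
    simp only [ρ, AddMonoidHom.coe_mulLeft, map_one, one_mul]
  refine congrFun (crossedHom_ext hρ (δ := fun u => boundary π (gradient π u))
    (ε := fun u => of ℤ G (π u) - 1) (fun u v => ?_) (fun u v => ?_) fun y => ?_) u
  · simp only [gradient_mul, map_add, map_smul, smul_eq_mul, ρ, AddMonoidHom.coe_mulLeft]
  · simp only [ρ, AddMonoidHom.coe_mulLeft, map_mul, mul_sub, mul_one]
    abel
  · simp only [gradient_of, boundary, Finsupp.linearCombination_single, one_smul]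

theorem map_eq_one_of_gradient_eq_zero {u : FreeGroup Y} (hu : gradient π u = 0) : π u = 1 := by
  have h := boundary_gradient π u
  rw [hu, map_zero, eq_comm, sub_eq_zero] at h
  exact MonoidAlgebra.of_injective (h.trans (map_one _).symm)

/-- The additive map `N^ab → ℤ[G]^(Y)`, `[n] ↦ gradient n`, where `N = ker π`. -/
noncomputable def relationGradient :
    Additive (Abelianization π.ker) →+ (Y →₀ MonoidAlgebra ℤ G) :=
  MonoidHom.toAdditiveLeft (Abelianization.lift (MonoidHom.mk'
    (fun n => Multiplicative.ofAdd (gradient π n)) fun n k => by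
      rw [Subgroup.coe_mul, gradient_mul_of_mem_ker π n.2, ofAdd_add]))

theorem relationGradient_of (n : π.ker) :
    relationGradient π (.ofMul (.of n)) = gradient π n := rfl

variable {π} {σ : G → FreeGroup Y} (hσ : Function.RightInverse σ π)

theorem relationGradient_schreierClass (u : FreeGroup Y) (a : G) :
    relationGradient π (schreierClass hσ u a) =
      of ℤ G a • gradient π u - (gradient π (σ (a * π u)) - gradient π (σ a)) := by
  rw [schreierClass, relationGradient_of, eq_sub_iff_add_eq, add_sub,
    sub_eq_iff_eq_add, ← gradient_mul_of_mem_ker π (Subtype.prop _), inv_mul_cancel_right,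
    gradient_mul, hσ, add_comm]

/-- The additive map `ℤ[G]^(Y) → N^ab` with `a e_y ↦ [σ(a) y σ(a π(y))⁻¹]` for `a ∈ G`,
where `N = ker π`. -/
noncomputable def relationClass :
    (Y →₀ MonoidAlgebra ℤ G) →ₗ[ℤ] Additive (Abelianization π.ker) :=
  (Finsupp.basis fun _ => MonoidAlgebra.basis G ℤ).constr ℤ
    fun i : (_ : Y) × G => schreierClass hσ (FreeGroup.of i.1) i.2

theorem relationClass_single (y : Y) (a : G) :
    relationClass hσ (Finsupp.single y (of ℤ G a)) = schreierClass hσ (FreeGroup.of y) a := by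
  have h := (Finsupp.basis fun _ : Y => MonoidAlgebra.basis G ℤ).constr_basis ℤ
    (fun i => schreierClass hσ (FreeGroup.of i.1) i.2) ⟨y, a⟩
  rwa [Finsupp.coe_basis] at h

theorem relationClass_smul_gradient (u : FreeGroup Y) (a : G) :
    relationClass hσ (of ℤ G a • gradient π u) = schreierClass hσ u a := by
  let ρ (u : FreeGroup Y) := (LinearMap.funLeft ℤ (Additive (Abelianization π.ker))
    fun a : G => a * π u).toAddMonoidHom
  have hρ (φ : G → Additive (Abelianization π.ker)) : ρ 1 φ = φ := by
    ext a
    simp [ρ, LinearMap.funLeft_apply]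
  refine congrFun (congrFun (crossedHom_ext hρ
    (δ := fun u a => relationClass hσ (of ℤ G a • gradient π u))
    (ε := fun u a => schreierClass hσ u a) (fun u v => ?_) (fun u v => ?_) fun y => ?_) u) a
  · ext a
    simp only [gradient_mul, smul_add, map_add, smul_smul, ← map_mul]
    rfl
  · ext a
    exact schreierClass_mul hσ u v a
  · ext a
    rw [gradient_of, Finsupp.smul_single, smul_eq_mul, mul_one, relationClass_single]

/-- The additive map `ℤ[G] → ℤ[G]^(Y)` with `a ↦ gradient σ(a)` for `a ∈ G`. -/
noncomputable def sectionGradient (π : FreeGroup Y →* G) (σ : G → FreeGroup Y) :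
    MonoidAlgebra ℤ G →ₗ[ℤ] (Y →₀ MonoidAlgebra ℤ G) :=
  (MonoidAlgebra.basis G ℤ).constr ℤ fun a => gradient π (σ a)

theorem sectionGradient_of (a : G) : sectionGradient π σ (of ℤ G a) = gradient π (σ a) :=
  (MonoidAlgebra.basis G ℤ).constr_basis ℤ _ a

theorem relationGradient_relationClass (x : Y →₀ MonoidAlgebra ℤ G) :
    relationGradient π (relationClass hσ x) = x - sectionGradient π σ (boundary π x) := by
  suffices h : (relationGradient π).toIntLinearMap ∘ₗ relationClass hσ =
      LinearMap.id - sectionGradient π σ ∘ₗ (boundary π).restrictScalars ℤ from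
    DFunLike.congr_fun h x
  refine (Finsupp.basis fun _ : Y => MonoidAlgebra.basis G ℤ).ext fun ⟨y, a⟩ => ?_
  rw [Finsupp.coe_basis]
  change relationGradient π (relationClass hσ (Finsupp.single y (of ℤ G a))) =
    Finsupp.single y (of ℤ G a) - sectionGradient π σ (boundary π (Finsupp.single y (of ℤ G a)))
  rw [relationClass_single, relationGradient_schreierClass, gradient_of,
    Finsupp.smul_single, smul_eq_mul, mul_one, boundary, Finsupp.linearCombination_single,
    smul_eq_mul, mul_sub, mul_one, ← map_mul, map_sub, sectionGradient_of, sectionGradient_of]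

variable (hπ : Function.Surjective π)
include hπ

theorem gradient_eq_zero_iff {u : FreeGroup Y} :
    gradient π u = 0 ↔ u ∈ ⁅π.ker, π.ker⁆ := by
  refine ⟨fun hu => ?_, fun hu => ?_⟩
  · rw [← schreierClass_one_eq_zero_iff (Function.rightInverse_surjInv hπ)
      (map_eq_one_of_gradient_eq_zero π hu), ← relationClass_smul_gradient, hu, smul_zero, map_zero]
  · have hn := Subgroup.commutator_le_self π.ker hu
    rw [← relationGradient_of π ⟨u, hn⟩, abelianization_of_eq_one_iff.mpr hu, ofMul_one, map_zero]

theorem exists_gradient_eq_iff {x : Y →₀ MonoidAlgebra ℤ G} :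
    (∃ u, gradient π u = x) ↔ ∃ g, boundary π x = of ℤ G g - 1 := by
  refine ⟨fun ⟨u, hu⟩ => ⟨π u, hu ▸ boundary_gradient π u⟩, fun ⟨g, hg⟩ => ?_⟩
  have hσ := Function.rightInverse_surjInv hπ
  obtain ⟨v, rfl⟩ := hπ g
  obtain ⟨n, hn⟩ : ∃ n : π.ker, Abelianization.of n =
      (relationClass hσ (x - gradient π v)).toMul := QuotientGroup.mk_surjective _
  have hnv : gradient π n = x - gradient π v := by
    rw [← relationGradient_of, hn, ofMul_toMul, relationGradient_relationClass, map_sub,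
      hg, boundary_gradient, sub_self, map_zero, sub_zero]
  exact ⟨n * v, by rw [gradient_mul_of_mem_ker π n.2, hnv, sub_add_cancel]⟩

end Gradient

end Fox

namespace FreeCommWire

variable {X : Type*}

theorem Mono.coe_mul (m l : Mono X) : (m * l).1 = m.1 + l.1 := rfl

theorem Mono.induction_on {p : Mono X → Prop} (m : Mono X) (var : ∀ x, p (Mono.var x))
    (mul : ∀ m l, p m → p l → p (m * l)) : p m := by
  suffices h : ∀ (s : X →₀ ℕ) (hs : s ≠ 0), p ⟨s, hs⟩ from h m.1 m.2
  intro s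
  induction s using Finsupp.induction_linear with
  | zero => exact fun hs => absurd rfl hs
  | add s t ihs iht =>
    intro hst
    by_cases hs : s = 0
    · subst hs
      simpa only [zero_add] using iht (by rwa [zero_add] at hst)
    by_cases ht : t = 0
    · subst ht
      simpa only [add_zero] using ihs hs
    exact mul ⟨s, hs⟩ ⟨t, ht⟩ (ihs hs) (iht ht)
  | single x k =>
    induction k with
    | zero => exact fun hs => absurd (Finsupp.single_zero x) hs
    | succ k ih =>
      intro hs
      by_cases hk : k = 0
      · subst hk
        exact var x
      · let m : Mono X := ⟨Finsupp.single x k, Finsupp.single_ne_zero.mpr hk⟩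
        have hm : m * Mono.var x = ⟨Finsupp.single x (k + 1), hs⟩ :=
          Subtype.ext (Finsupp.single_add x k 1).symm
        exact hm ▸ mul m (Mono.var x) (ih m.2) (var x)

section Exponent

/-- The homomorphism out of `F/N` induced by a multiplicative map on the monomials. -/
noncomputable def liftFmodN {A : Type*} [Group A] (f : Mono X →ₙ* A) : FmodN X →* A :=
  QuotientGroup.lift (N X) (FreeGroup.lift f) <| Subgroup.normalClosure_le_normal <| by
    rintro _ ⟨m, l, rfl⟩
    simp [mul_assoc]

theorem liftFmodN_gen {A : Type*} [Group A] (f : Mono X →ₙ* A) (m : Mono X) :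
    liftFmodN f (toN (gen m)) = f m :=
  FreeGroup.lift_apply_of

theorem FmodN.hom_ext {A : Type*} [Monoid A] {φ ψ : FmodN X →* A}
    (h : ∀ x, φ (toN (gen (Mono.var x))) = ψ (toN (gen (Mono.var x)))) : φ = ψ := by
  refine QuotientGroup.monoidHom_ext _ (FreeGroup.ext_hom _ _ fun m => ?_)
  change φ (toN (gen m)) = ψ (toN (gen m))
  induction m using Mono.induction_on with
  | var x => exact h x
  | mul m l hm hl => rw [toN_gen_mul, map_mul, map_mul, hm, hl]

/-- The homomorphism `F/N → ℤ^(X)` that sends the class of a monomial to its exponent vector. -/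
noncomputable def toExponent : FmodN X →* Multiplicative (X →₀ ℤ) :=
  liftFmodN
    { toFun m := .ofAdd (Finsupp.mapRange.addMonoidHom (Nat.castAddMonoidHom ℤ) m.1)
      map_mul' m l := by rw [Mono.coe_mul, map_add, ofAdd_add] }

theorem toExponent_var (x : X) :
    toExponent (toN (gen (Mono.var x))) = .ofAdd (Finsupp.single x 1) := by
  rw [toExponent, liftFmodN_gen]
  simp [Mono.var]

/-- The homomorphism `ℤ^(X) → F/N` that sends the basis vector of `x` to `[x]`. -/
noncomputable def ofExponent : Multiplicative (X →₀ ℤ) →* FmodN X :=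
  AddMonoidHom.toMultiplicativeLeft <| Finsupp.liftAddHom fun x =>
    zmultiplesHom _ (.ofMul (toN (gen (Mono.var x))))

theorem ofExponent_single (x : X) :
    ofExponent (.ofAdd (Finsupp.single x 1)) = toN (gen (Mono.var x)) := by
  refine congrArg Additive.toMul ((Finsupp.liftAddHom_apply_single _ x (1 : ℤ)).trans ?_)
  exact one_zsmul _

/-- The isomorphism of `F/N` with the free commutative group `ℤ^(X)`. -/
noncomputable def exponentEquiv : FmodN X ≃* Multiplicative (X →₀ ℤ) :=
  MonoidHom.toMulEquiv toExponent ofExponent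
    (FmodN.hom_ext fun x => by
      rw [MonoidHom.comp_apply, toExponent_var, ofExponent_single, MonoidHom.id_apply])
    (MonoidHom.toAdditive.injective <| Finsupp.addHom_ext' fun x => AddMonoidHom.ext_int <| by
      change toExponent (ofExponent (.ofAdd (Finsupp.single x 1))) = .ofAdd (Finsupp.single x 1)
      rw [ofExponent_single, toExponent_var])

theorem exponentEquiv_var (x : X) :
    exponentEquiv (toN (gen (Mono.var x))) = .ofAdd (Finsupp.single x 1) :=
  toExponent_var x

end Exponent

section Augmentation

open MvPolynomial

variable (R : Type*) [CommRing R]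

/-- The `R`-linear map `(a_s) ↦ ∑ₛ a_s (t_s - 1)` from families indexed by the monomials. -/
noncomputable def augmentationSum : (Mono X →₀ R) →ₗ[R] MvPolynomial X R :=
  Finsupp.linearCombination R fun s => monomial s.1 1 - 1

variable {R}

theorem coeff_augmentationSum (a : Mono X →₀ R) (s : Mono X) :
    coeff s.1 (augmentationSum R a) = a s := by
  classical
  suffices h : lcoeff R s.1 ∘ₗ augmentationSum R = Finsupp.lapply s from DFunLike.congr_fun h a
  ext m
  have hms : m.1 = s.1 ↔ m = s := Subtype.ext_iff.symm
  simp [augmentationSum, coeff_monomial, coeff_one, s.2.symm, Finsupp.single_apply, hms]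

theorem augmentationSum_injective :
    Function.Injective (augmentationSum R : (Mono X →₀ R) → MvPolynomial X R) := fun a b h =>
  Finsupp.ext fun s => by rw [← coeff_augmentationSum, h, coeff_augmentationSum]

theorem eval_one_augmentationSum (a : Mono X →₀ R) :
    eval (fun _ => 1) (augmentationSum R a) = 0 := by
  simp [augmentationSum, Finsupp.linearCombination_apply, Finsupp.sum, smul_eq_C_mul,
    eval_monomial]

theorem exists_augmentationSum_eq_sub (p : MvPolynomial X R) :
    ∃ a, augmentationSum R a = p - C (eval (fun _ => 1) p) := by
  induction p using MvPolynomial.induction_on' with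
  | add p q hp hq =>
    obtain ⟨⟨a, ha⟩, b, hb⟩ := hp, hq
    exact ⟨a + b, by rw [map_add, ha, hb, map_add, map_add, add_sub_add_comm]⟩
  | monomial s r =>
    have h : eval (fun _ => (1 : R)) (monomial s r) = r := by simp [eval_monomial]
    rw [h]
    by_cases hs : s = 0
    · exact ⟨0, by rw [hs, monomial_zero', sub_self, map_zero]⟩
    · obtain ⟨m, rfl⟩ : ∃ m : Mono X, m.1 = s := ⟨⟨s, hs⟩, rfl⟩
      refine ⟨Finsupp.single m r, ?_⟩
      rw [augmentationSum, Finsupp.linearCombination_single, smul_sub, smul_monomial, smul_eq_mul,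
        mul_one, smul_eq_C_mul, mul_one]

theorem exists_augmentationSum_eq_iff {p : MvPolynomial X R} :
    (∃ a, augmentationSum R a = p) ↔ eval (fun _ => 1) p = 0 := by
  refine ⟨fun ⟨a, ha⟩ => ha ▸ eval_one_augmentationSum a, fun hp => ?_⟩
  simpa only [hp, map_zero, sub_zero] using exists_augmentationSum_eq_sub p

end Augmentation

section FoxWire

open MvPolynomial

theorem evalX_monomial (m : Mono X) : evalX (monomial m.1 1) = emb (toN (gen m)) := by
  induction m using Mono.induction_on with
  | var x => exact eval_X x
  | mul m l hm hl =>
    rw [Mono.coe_mul, ← mul_one (1 : Coeff X), ← monomial_mul, map_mul, hm, hl, toN_gen_mul,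
      map_mul]

theorem evalX_augmentationSum (a : Mono X →₀ Coeff X) :
    evalX (augmentationSum (Coeff X) a) = Fox.boundary toN a := by
  simp only [augmentationSum, Fox.boundary, Finsupp.linearCombination_apply, Finsupp.sum, map_sum,
    smul_eq_C_mul, map_mul, map_sub, map_one, PolyWire.evalX_C, evalX_monomial, smul_eq_mul]

theorem foxPoly_eq (u : F X) :
    foxPoly u = 1 + augmentationSum (Coeff X) (Fox.gradient toN u) := by
  let g := Fox.gradient toN u
  have hconst : ∑ᶠ s, foxDeriv s u = g.sum fun _ a => a :=
    finsum_eq_finsuppSum g (h := fun _ a => a) fun _ => rfl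
  have hlin : ∑ᶠ s : Mono X, C (foxDeriv s u) * monomial s.1 1 =
      g.sum fun s a => C a * monomial s.1 1 :=
    finsum_eq_finsuppSum g (h := fun s a => C a * monomial s.1 1) fun s => by
      rw [map_zero, zero_mul]
  simp only [foxPoly, hconst, hlin, g, augmentationSum, Finsupp.linearCombination_apply,
    Finsupp.sum, smul_eq_C_mul, mul_sub, mul_one, Finset.sum_sub_distrib, map_sub, map_one, map_sum]
  abel

theorem foxPoly_gen (m : Mono X) : foxPoly (gen m) = monomial m.1 1 := by
  rw [foxPoly_eq, Fox.gradient_of, augmentationSum, Finsupp.linearCombination_single, one_smul,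
    add_sub_cancel]

theorem evalX_foxPoly (u : F X) : evalX (foxPoly u) = emb (toN u) := by
  rw [foxPoly_eq, map_add, map_one, evalX_augmentationSum, Fox.boundary_gradient, add_sub_cancel]

theorem foxPoly_mul (u v : F X) :
    foxPoly (u * v) = foxPoly u + C (evalX (foxPoly u)) * (foxPoly v - 1) := by
  rw [evalX_foxPoly, foxPoly_eq, foxPoly_eq, foxPoly_eq, Fox.gradient_mul, map_add, map_smul,
    smul_eq_C_mul, add_sub_cancel_left, add_assoc]

/-- The homomorphism `F → 𝒲(X)`, `u ↦ f_u`. -/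
noncomputable def foxWire : F X →* PolyWire X :=
  MonoidHom.mk'
    (fun u =>
      { poly := foxPoly u
        evalOne_poly := by
          rw [foxPoly_eq, map_add, map_one, evalOne, eval_one_augmentationSum, add_zero]
        evalX_poly := ⟨toN u, evalX_foxPoly u⟩ })
    fun u v => PolyWire.ext (foxPoly_mul u v)

theorem foxWire_poly (u : F X) : (foxWire u).poly = foxPoly u := rfl

theorem foxWire_gen_mul (m l : Mono X) :
    foxWire (gen (m * l)) = foxWire (gen m) ⊚ foxWire (gen l) :=
  PolyWire.ext <| by
    change foxPoly (gen (m * l)) = foxPoly (gen m) * foxPoly (gen l)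
    rw [foxPoly_gen, foxPoly_gen, foxPoly_gen, monomial_mul, mul_one, Mono.coe_mul]

theorem foxWire_ker : foxWire.ker = ⁅N X, N X⁆ := by
  ext u
  rw [← QuotientGroup.ker_mk' (N X), ← Fox.gradient_eq_zero_iff (QuotientGroup.mk'_surjective _),
    MonoidHom.mem_ker, PolyWire.ext_iff]
  change foxPoly u = 1 ↔ _
  rw [foxPoly_eq, add_eq_left, map_eq_zero_iff _ augmentationSum_injective]

theorem foxWire_surjective : Function.Surjective (foxWire (X := X)) := by
  intro f
  obtain ⟨a, ha⟩ := exists_augmentationSum_eq_iff (p := f.poly - 1).mpr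
    (by rw [map_sub, map_one, sub_eq_zero]; exact f.evalOne_poly)
  obtain ⟨g, hg⟩ := f.evalX_poly
  obtain ⟨u, rfl⟩ := (Fox.exists_gradient_eq_iff (QuotientGroup.mk'_surjective (N X))).mpr
    ⟨g, by rw [← evalX_augmentationSum, ha, map_sub, map_one, hg]⟩
  exact ⟨u, PolyWire.ext (by rw [foxWire_poly, foxPoly_eq, ha, add_sub_cancel])⟩

end FoxWire

section Circ

variable {W : Type*} [Wire W] {φ : F X →* W}
  (hφ : ∀ m l, φ (gen (m * l)) = φ (gen m) ⊚ φ (gen l))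
include hφ

theorem map_rhoMono_mul_gen (m : Mono X) (u : F X) :
    φ (rhoMono m u) * φ (gen m) = φ u ⊚ φ (gen m) := by
  let ψ : F X →* W := MonoidHom.mk' (fun u => (φ u ⊚ φ (gen m)) * (φ (gen m))⁻¹)
    fun u v => by simp only [map_mul, Wire.mul_circ, mul_assoc]
  have h : φ.comp (rhoMono m) = ψ := FreeGroup.ext_hom _ _ fun l => by
    change φ (rhoMono m (gen l)) = (φ (gen l) ⊚ φ (gen m)) * (φ (gen m))⁻¹
    rw [rhoMono, FreeGroup.lift_apply_of, map_mul, map_inv, hφ]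
  exact eq_mul_inv_iff_mul_eq.mp (DFunLike.congr_fun h u)

theorem map_circL (u v : F X) : φ (circL u v) = φ u ⊚ φ v := by
  let ψ : F X →* W := MonoidHom.mk' (fun v => (φ u)⁻¹ * (φ u ⊚ φ v))
    fun v w => by simp only [map_mul, Wire.circ_mul, mul_assoc]
  have h : φ.comp (lam u) = ψ := FreeGroup.ext_hom _ _ fun m => by
    change φ (lam u (gen m)) = (φ u)⁻¹ * (φ u ⊚ φ (gen m))
    rw [lam, FreeGroup.lift_apply_of, map_mul, map_inv, map_mul, map_rhoMono_mul_gen hφ]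
  rw [circL, map_mul]
  exact eq_inv_mul_iff_mul_eq.mp (DFunLike.congr_fun h v)

end Circ

end FreeCommWire

open FreeCommWire in
theorem mainTheorem2 (X : Type*) :
    (∃ φ : FmodN X ≃* Multiplicative (X →₀ ℤ),
      ∀ x : X, φ (toN (gen (Mono.var x))) = Multiplicative.ofAdd (Finsupp.single x 1)) ∧
    ∃ 𝔡 : FmodN' X → PolyWire X,
      (∀ u : F X, (𝔡 (toN' u)).poly = foxPoly u) ∧ IsWireIso 𝔡 := by
  refine ⟨⟨exponentEquiv, exponentEquiv_var⟩, ?_⟩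
  let 𝔡 : FmodN' X ≃* PolyWire X := QuotientGroup.liftEquiv _ foxWire_surjective foxWire_ker.symm
  refine ⟨𝔡, foxWire_poly, ⟨map_mul 𝔡, fun a b => ?_⟩, 𝔡.bijective⟩
  obtain ⟨u, rfl⟩ := QuotientGroup.mk'_surjective _ a
  obtain ⟨v, rfl⟩ := QuotientGroup.mk'_surjective _ b
  exact map_circL foxWire_gen_mul u v
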